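/- Let $X$ be a topological manifold without boundary of dimension $n$ (Hausdorff, second countable), and let $\Phi : X\times\mathbb{R}\to X$ be a continuous flow. Let $S\subset X$ be a global Poincaré section of $\Phi$, that is: (a) $S$ is a closed subset of $X$ and a locally flat submanifold of codimension one without boundary: each $x\in S$ has a neighborhood $U$ in $X$ with a homeomorphism $\phi$ of $U$ onto the open unit ball $B\subset\mathbb{R}^n$ such that $\phi(U\cap S)=B\cap(\mathbb{R}^{n-1}\times\{0\})$; (b) there are functions $\delta_+>0$ and $\delta_-<0$ on $S$ such that, for each $x\in S$, a neighborhood $U$ as in (a) can be chosen so that $\Phi(x,[\delta_-(x),0))$ and $\Phi(x,(0,\delta_+(x)])$ are contained in different connected components of $U\setminus S$, and $\Phi(x,[\delta_-(x),\delta_+(x)])\cap S=\{x\}$; moreover there are a neighborhood $V\subset U$ of $x$ and $\delta>0$ with $\delta_+(y)>\delta$ and $\delta_-(y)<-\delta$ for all $y\in V\cap S$; (c) $\Phi(y,[a,b])\cap S$ is compact for all $y\in X$ and $a,b\in\mathbb{R}$; (d) for each $x\in X$ there are $t_+>0$ and $t_-<0$ with $\Phi(x,t_+)\in S$ and $\Phi(x,t_-)\in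 S$. Then the first return time $T_\Phi(x)=\min\{t>0 : \Phi(x,t)\in S\}$ exists for every $x\in S$, and the Poincaré map $f=P\Phi: S\to S$, $f(x)=\Phi(x,T_\Phi(x))$, is a homeomorphism. Let $S_f=S\times[0,1]/\!\sim$ be its mapping torus, where $\sim$ is the smallest equivalence relation with $(x,1)\sim(f(x),0)$, let $\Sigma f$ be the suspension flow on $S_f$, given by $\Sigma f([x,t],s)=[f^m(x),s+t-m]$ with $m=\lfloor s+t\rfloor$, and let $(S_f)_0=\{[x,0]: x\in S\}$. Then $S_f$ is a topological manifold of dimension $n$, $(S_f)_0$ is a global Poincaré section of $\Sigma f$, and $(\Phi,X,S)$ is topologically equivalent to $(\Sigma f,S_f,(S_f)_0)$ by an equivalence preserving the sections. Here a weak morphism $(\Phi,X)\to(\Psi,Y)$ is a pair $(h,\tau)$ of a continuous map $h:X\to Y$ and a map $\tau:X\times\mathbb{R}\to\mathbb{R}$ such that $h(\Phi(x,t))=\Psi(h(x),\tau(x,t))$ and each $\tau(x,-)$ is an increasing homeomorphism of $\mathbb{R}$ with $\tau(x,0)=0$. It preserves sections $S\subset X$, $S'\subset Y$ if $S=h^{-1}(S')$.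 The composition of $(h_1,\tau_1)$ followed by $(h_2,\tau_2)$ is $(h_2\circ h_1,\ (x,t)\mapsto\tau_2(h_1(x),\tau_1(x,t)))$, and the identity is $(\mathrm{id}_X,\ (x,t)\mapsto t)$. A topological equivalence preserving sections is a section-preserving weak morphism that has a section-preserving weak morphism as two-sided inverse for this composition. -/

import Mathlib

open Set Topology

/-- `X` is a topological manifold (without boundary) of dimension `n`: Hausdorff, second countable
and covered by charts with values in `ℝⁿ`. -/
structure IsTopologicalManifold (n : ℕ) (X : Type*) [TopologicalSpace X] : Prop where
  t2 : T2Space X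
  secondCountable : SecondCountableTopology X
  locallyEuclidean : Nonempty (ChartedSpace (EuclideanSpace ℝ (Fin n)) X)

section Transversality

variable {X : Type*} [TopologicalSpace X]

/-- There is a homeomorphism of `U` onto the open unit ball `B` of `ℝⁿ` which carries `U ∩ S` onto
`B ∩ (ℝⁿ⁻¹ × {0})`; the condition on `i` selects the last coordinate. -/
def IsFlatBall (n : ℕ) (S U : Set X) : Prop :=
  ∃ φ : U ≃ₜ Metric.ball (0 : EuclideanSpace ℝ (Fin n)) 1,
    ∀ u : U, (u : X) ∈ S ↔
      ∀ i : Fin n, (i : ℕ) + 1 = n → (φ u : EuclideanSpace ℝ (Fin n)) i = 0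

/-- `S` is a closed, locally flat submanifold of codimension one, without boundary, of the
`n`-dimensional manifold `X`. -/
structure IsLocallyFlatHypersurface (n : ℕ) (S : Set X) : Prop where
  isClosed : IsClosed S
  locallyFlat : ∀ x ∈ S, ∃ U ∈ 𝓝 x, IsFlatBall n S U

/-- `S` is topologically transversal to the flow `Φ` on the `n`-dimensional manifold `X`. -/
structure IsTopologicallyTransversal (n : ℕ) (Φ : Flow ℝ X) (S : Set X) : Prop where
  hypersurface : IsLocallyFlatHypersurface n S
  /-- Near each of its points, `S` is crossed by the orbits from one side to the other, during
  times `δm x < 0 < δp x` that are locally bounded away from `0`. -/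
  crossing : ∃ δp δm : X → ℝ, ∀ x ∈ S, 0 < δp x ∧ δm x < 0 ∧
    ∃ U ∈ 𝓝 x, IsFlatBall n S U ∧
      (∃ a ∈ U \ S, ∃ b ∈ U \ S,
        connectedComponentIn (U \ S) a ≠ connectedComponentIn (U \ S) b ∧
        (∀ t ∈ Ico (δm x) 0, Φ t x ∈ connectedComponentIn (U \ S) a) ∧
        (∀ t ∈ Ioc 0 (δp x), Φ t x ∈ connectedComponentIn (U \ S) b)) ∧
      ((fun t => Φ t x) '' Icc (δm x) (δp x)) ∩ S = {x} ∧
      ∃ V ∈ 𝓝 x, V ⊆ U ∧ ∃ δ > 0, ∀ y ∈ V ∩ S, δ < δp y ∧ δm y < -δ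
  compact_inter : ∀ (y : X) (a b : ℝ), IsCompact (((fun t => Φ t y) '' Icc a b) ∩ S)

/-- `S` is a global Poincaré section of the flow `Φ` on the `n`-dimensional manifold `X`. -/
structure IsGlobalPoincareSection (n : ℕ) (Φ : Flow ℝ X) (S : Set X) : Prop where
  transversal : IsTopologicallyTransversal n Φ S
  hits : ∀ x : X, (∃ t > 0, Φ t x ∈ S) ∧ (∃ t < 0, Φ t x ∈ S)

/-- `f` is the Poincaré (first return) map of `Φ` on `S`: `f x = Φ (T x) x`, where `T x` is the
smallest positive time at which the orbit of `x` is in `S`. -/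
def IsPoincareMap (Φ : Flow ℝ X) (S : Set X) (f : S → S) : Prop :=
  ∀ x : S, ∃ T : ℝ, IsLeast {t : ℝ | 0 < t ∧ Φ t x ∈ S} T ∧ (f x : X) = Φ T x

end Transversality

section WeakMorphisms

variable {X Y Z : Type*} [TopologicalSpace X] [TopologicalSpace Y] [TopologicalSpace Z]

/-- Weak morphisms `(h, τ)` of flows. -/
@[ext]
structure WeakMorphism (Φ : Flow ℝ X) (Ψ : Flow ℝ Y) where
  /-- the space part `h` -/
  toFun : X → Y
  /-- the time part `τ` -/
  time : X → ℝ → ℝ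
  continuous_toFun : Continuous toFun
  map_flow : ∀ x t, toFun (Φ t x) = Ψ (time x t) (toFun x)
  time_isHomeomorph : ∀ x, IsHomeomorph (time x)
  time_strictMono : ∀ x, StrictMono (time x)
  time_zero : ∀ x, time x 0 = 0

/-- The identity weak morphism. -/
def WeakMorphism.id (Φ : Flow ℝ X) : WeakMorphism Φ Φ where
  toFun x := x
  time _ t := t
  continuous_toFun := continuous_id
  map_flow _ _ := rfl
  time_isHomeomorph _ := IsHomeomorph.id
  time_strictMono _ := strictMono_id
  time_zero _ := rfl

/-- The composition of weak morphisms (first `k`, then `h`). -/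
def WeakMorphism.comp {Φ : Flow ℝ X} {Ψ : Flow ℝ Y} {Θ : Flow ℝ Z}
    (h : WeakMorphism Ψ Θ) (k : WeakMorphism Φ Ψ) : WeakMorphism Φ Θ where
  toFun x := h.toFun (k.toFun x)
  time x t := h.time (k.toFun x) (k.time x t)
  continuous_toFun := h.continuous_toFun.comp k.continuous_toFun
  map_flow x t := by rw [k.map_flow, h.map_flow]
  time_isHomeomorph x := (h.time_isHomeomorph _).comp (k.time_isHomeomorph x)
  time_strictMono x := (h.time_strictMono _).comp (k.time_strictMono x)
  time_zero x := by rw [k.time_zero, h.time_zero]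

/-- The weak morphism preserves the sections `S` and `S'`. -/
def WeakMorphism.PreservesSection {Φ : Flow ℝ X} {Ψ : Flow ℝ Y} (h : WeakMorphism Φ Ψ)
    (S : Set X) (S' : Set Y) : Prop :=
  S = h.toFun ⁻¹' S'

/-- `(Φ, X, S)` and `(Ψ, Y, S')` are topologically equivalent: they are isomorphic through weak
morphisms that preserve the sections. -/
def TopologicallyEquivalent (Φ : Flow ℝ X) (S : Set X) (Ψ : Flow ℝ Y) (S' : Set Y) : Prop :=
  ∃ (h : WeakMorphism Φ Ψ) (k : WeakMorphism Ψ Φ),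
    h.PreservesSection S S' ∧ k.PreservesSection S' S ∧
    k.comp h = WeakMorphism.id Φ ∧ h.comp k = WeakMorphism.id Ψ

end WeakMorphisms

section Suspension

variable {X : Type*} [TopologicalSpace X]

/-- The relation `(x, 1) ∼ (f x, 0)` on `X × [0, 1]`. -/
def mappingTorusRel (f : X ≃ₜ X) (p q : X × unitInterval) : Prop :=
  p.2 = 1 ∧ q = (f p.1, 0)

/-- The mapping torus of `f`: the quotient of `X × [0, 1]` by the smallest equivalence relation
with `(x, 1) ∼ (f x, 0)`. -/
def MappingTorus (f : X ≃ₜ X) : Type _ := Quot (mappingTorusRel f)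

instance (f : X ≃ₜ X) : TopologicalSpace (MappingTorus f) :=
  inferInstanceAs (TopologicalSpace (Quot (mappingTorusRel f)))

namespace MappingTorus

/-- The class of `(x, t)`. -/
def mk (f : X ≃ₜ X) (p : X × unitInterval) : MappingTorus f := Quot.mk _ p

/-- The section `{[x, 0] | x ∈ X}`. -/
def zeroSection (f : X ≃ₜ X) : Set (MappingTorus f) := range fun x : X => mk f (x, 0)

theorem isQuotientMap_mk (f : X ≃ₜ X) : IsQuotientMap (mk f) := isQuotientMap_quot_mk

theorem mk_one (f : X ≃ₜ X) (x : X) : mk f (x, 1) = mk f (f x, 0) := Quot.sound ⟨rfl, rfl⟩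

/-- The point `[fⁿ x, u - n]` of the mapping torus, where `n = ⌊u⌋`. -/
noncomputable def unroll (f : X ≃ₜ X) (u : ℝ) (x : X) : MappingTorus f :=
  mk f ((f ^ ⌊u⌋) x, ⟨Int.fract u, Int.fract_nonneg u, (Int.fract_lt_one u).le⟩)

theorem unroll_eq (f : X ≃ₜ X) (x : X) (u : ℝ) (n : ℤ) (h : u - n ∈ unitInterval) :
    unroll f u x = mk f ((f ^ n) x, ⟨u - n, h⟩) := by
  rcases h.2.lt_or_eq with h1 | h1
  · have hn : ⌊u⌋ = n := Int.floor_eq_iff.2 ⟨by linarith [h.1], by linarith⟩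
    subst hn
    rfl
  · have hu : u = ((n + 1 : ℤ) : ℝ) := by push_cast; linarith
    have e1 : (⟨u - n, h⟩ : unitInterval) = 1 := Subtype.ext h1
    have e2 : (⟨Int.fract u, Int.fract_nonneg u, (Int.fract_lt_one u).le⟩ : unitInterval) = 0 :=
      Subtype.ext ((congrArg Int.fract hu).trans (Int.fract_intCast _))
    have e3 : ⌊u⌋ = n + 1 := by rw [hu]; exact Int.floor_intCast _
    have e4 : unroll f u x = mk f ((f ^ ⌊u⌋) x, 0) := congrArg (fun r => mk f (_, r)) e2
    rw [e1, mk_one, e4, e3, add_comm, zpow_add, zpow_one]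
    rfl

theorem unroll_coe (f : X ≃ₜ X) (x : X) (t : unitInterval) :
    unroll f (t : ℝ) x = mk f (x, t) := by
  have h : (t : ℝ) - (0 : ℤ) ∈ unitInterval := by simp
  rw [unroll_eq f x t 0 h]
  simp

theorem unroll_add_one (f : X ≃ₜ X) (x : X) (u : ℝ) :
    unroll f (u + 1) x = unroll f u (f x) := by
  simp only [unroll, Int.floor_add_one, Int.fract_add_one, zpow_add, zpow_one]
  rfl

theorem unroll_unroll (f : X ≃ₜ X) (x : X) (s u : ℝ) :
    unroll f (s + Int.fract u) ((f ^ ⌊u⌋) x) = unroll f (s + u) x := by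
  have h : s + u = s + Int.fract u + (⌊u⌋ : ℤ) := by
    rw [add_assoc, Int.fract_add_floor]
  rw [h]
  simp only [unroll, Int.floor_add_intCast, Int.fract_add_intCast, zpow_add]
  rfl

theorem continuous_unroll (f : X ≃ₜ X) :
    Continuous fun p : ℝ × X => unroll f p.1 p.2 := by
  have hlf : LocallyFinite fun n : ℤ => (Prod.fst : ℝ × X → ℝ) ⁻¹' Icc (n : ℝ) (n + 1) := by
    refine LocallyFinite.preimage_continuous (fun x => ?_) continuous_fst
    refine ⟨Ioo (x - 1) (x + 1), Ioo_mem_nhds (by linarith) (by linarith), ?_⟩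
    refine (Set.finite_Icc (⌊x⌋ - 3) (⌊x⌋ + 3)).subset ?_
    rintro n ⟨y, ⟨h1, h2⟩, h3, h4⟩
    have := Int.floor_le x
    have := Int.lt_floor_add_one x
    constructor
    · have : ((⌊x⌋ - 3 : ℤ) : ℝ) ≤ n := by push_cast; linarith
      exact_mod_cast this
    · have : (n : ℝ) ≤ ((⌊x⌋ + 3 : ℤ) : ℝ) := by push_cast; linarith
      exact_mod_cast this
  refine hlf.continuous ?_ (fun n => isClosed_Icc.preimage continuous_fst) fun n => ?_
  · refine eq_univ_of_forall fun p => mem_iUnion.2 ⟨⌊p.1⌋, Int.floor_le _, ?_⟩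
    exact (Int.lt_floor_add_one _).le
  · have hc : Continuous fun p : ℝ × X =>
        mk f ((f ^ n) p.2, projIcc (0 : ℝ) 1 zero_le_one (p.1 - n)) :=
      (isQuotientMap_mk f).continuous.comp
        (((f ^ n).continuous.comp continuous_snd).prodMk
          (continuous_projIcc.comp (continuous_fst.sub continuous_const)))
    refine hc.continuousOn.congr fun p hp => ?_
    have h : p.1 - n ∈ unitInterval := ⟨by linarith [hp.1], by linarith [hp.2]⟩
    simp only [unroll_eq f p.2 p.1 n h, projIcc_of_mem zero_le_one h]

end MappingTorus

open MappingTorus in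
/-- The suspension flow of `f`: in time `s`, the point `[x, t]` moves to `[fⁿ x, s + t - n]`, where
`n = ⌊s + t⌋`. -/
noncomputable def suspensionFlow (f : X ≃ₜ X) : Flow ℝ (MappingTorus f) where
  toFun s := Quot.lift (fun p => unroll f (s + p.2) p.1) (by
    rintro ⟨x, t⟩ q ⟨ht, rfl⟩
    obtain rfl : t = 1 := ht
    simpa using unroll_add_one f x s)
  cont' := by
    refine (isQuotientMap_mk f).continuous_lift_prod_right ?_
    exact (continuous_unroll f).comp
      (f := fun q : ℝ × (X × unitInterval) => ((q.1 + (q.2.2 : ℝ), q.2.1) : ℝ × X)) (by fun_prop)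
  map_add' s t p := by
    induction p using Quot.ind with
    | mk p =>
      change unroll f (s + t + p.2) p.1 = unroll f (s + Int.fract (t + (p.2 : ℝ))) _
      rw [unroll_unroll, add_assoc]
  map_zero' p := by
    induction p using Quot.ind with
    | mk p =>
      change unroll f (0 + p.2) p.1 = mk f p
      rw [zero_add, unroll_coe]

end Suspension

open Filter

/-! Each point of X lies on exactly one half-open orbit arc from a point x of S to its next return,
so (x, t) ↦ Φ(t T(x), x) should identify the mapping torus with X. Everything rests on the return
time T being positive and continuous on S. Local flatness turns a crossing into a sign change of a
real function (`IsFlatBall.exists_signed_function`), so hits persist for nearby orbits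
(`eventually_exists_hit`) and T is upper semicontinuous; the locally uniform gap between hits gives
lower semicontinuity. The same facts for the reversed flow make the inverse of the Poincaré map
continuous.

The identification is a continuous bijection, and it is closed because `sweep` is proper
(`isProperMap_sweep`). It carries orbits to orbits, with time changed by the piecewise affine
`turnTime`, which interpolates the successive hit times. This is onto ℝ because hit times cannot
accumulate (`not_tendsto_hitTime`).

Finally the section property is pulled back from X to the torus. Crossing times get reparametrized,
and their local lower bounds survive because T is locally bounded
(`IsGlobalPoincareSection.preimage`). -/

/-! ### The two sides of a flat ball -/

/-- The last coordinate of a flat ball, signed so that the hypersurface separates the component of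
`a` (negative) from the component of `b` (positive). -/
theorem IsFlatBall.exists_signed_function {X : Type*} [TopologicalSpace X] {n : ℕ} {S U : Set X}
    (hU : IsFlatBall n S U) {a b : X} (ha : a ∈ U \ S) (hb : b ∈ U \ S)
    (hab : connectedComponentIn (U \ S) a ≠ connectedComponentIn (U \ S) b) :
    ∃ g : X → ℝ, ContinuousOn g U ∧ (∀ y ∈ U, y ∈ S ↔ g y = 0) ∧
      (∀ y ∈ connectedComponentIn (U \ S) a, g y < 0) ∧
      ∀ y ∈ connectedComponentIn (U \ S) b, 0 < g y := by
  classical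
  obtain ⟨φ, hφ⟩ := hU
  -- In dimension 0 the coordinate condition is vacuous, so U ⊆ S, contradicting `a ∉ S`.
  obtain _ | m := n
  · exact absurd ((hφ ⟨a, ha.1⟩).2 fun i => i.elim0) ha.2
  have hφ' (u : U) :
      (u : X) ∈ S ↔ (φ u : EuclideanSpace ℝ (Fin (m + 1))) (Fin.last m) = 0 := by
    rw [hφ u]
    refine ⟨fun h => h _ (by simp), fun h i hi => ?_⟩
    rwa [show i = Fin.last m from Fin.ext (by simpa using hi)]
  let g : X → ℝ := fun y =>
    if h : y ∈ U then (φ ⟨y, h⟩ : EuclideanSpace ℝ (Fin (m + 1))) (Fin.last m) else 0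
  have hg (u : U) : g u = (φ u : EuclideanSpace ℝ (Fin (m + 1))) (Fin.last m) := dif_pos u.2
  have hgc : ContinuousOn g U := by
    rw [continuousOn_iff_continuous_domRestrict]
    have : U.domRestrict g = fun u : U => (φ u : EuclideanSpace ℝ (Fin (m + 1))) (Fin.last m) :=
      funext hg
    rw [this]
    fun_prop
  have hgS (y : X) (hy : y ∈ U) : y ∈ S ↔ g y = 0 := by rw [hφ' ⟨y, hy⟩, ← hg]
  -- The sign of σ selects one of the two open half-balls, which are convex and hence connected.
  have half (σ : ℝ) : IsPreconnected {y | y ∈ U ∧ 0 < σ * g y} := by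
    let B := Metric.ball (0 : EuclideanSpace ℝ (Fin (m + 1))) 1
    have h1 : IsPreconnected (B ∩ {z | 0 < σ * z (Fin.last m)}) := by
      refine Convex.isPreconnected ((convex_ball _ _).inter ?_)
      refine convex_halfSpace_gt (f := fun z : EuclideanSpace ℝ (Fin (m + 1)) =>
        σ * z (Fin.last m)) ⟨fun x y => ?_, fun c x => ?_⟩ 0
      · simp [mul_add]
      · simp; ring
    have h2 : IsPreconnected {z : B | 0 < σ * (z : EuclideanSpace ℝ (Fin (m + 1))) (Fin.last m)} := by
      rw [← IsInducing.subtypeVal.isPreconnected_image]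
      convert h1 using 1
      ext z
      simp [B, and_comm]
    convert h2.image (fun z => (φ.symm z : X)) (by fun_prop) using 1
    ext y
    constructor
    · rintro ⟨hy, h⟩
      exact ⟨φ ⟨y, hy⟩, by simpa [← hg] using h, by simp⟩
    · rintro ⟨z, hz, rfl⟩
      exact ⟨(φ.symm z).2, by simpa [hg] using hz⟩
  have comp (σ : ℝ) {c d : X} (hc : c ∈ U) (hd : d ∈ U) (hc' : 0 < σ * g c)
      (hd' : 0 < σ * g d) : connectedComponentIn (U \ S) c = connectedComponentIn (U \ S) d := by
    refine connectedComponentIn_eq ((half σ).subset_connectedComponentIn ⟨hc, hc'⟩ ?_ ⟨hd, hd'⟩)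
    rintro y ⟨hy, hy'⟩
    refine ⟨hy, fun h => ?_⟩
    rw [(hgS y hy).1 h, mul_zero] at hy'
    exact hy'.false
  have ga : g a ≠ 0 := fun h => ha.2 ((hgS a ha.1).2 h)
  -- By the intermediate value theorem, g keeps its sign on a component of U \ S.
  have sign {c y : X} (hc : c ∈ U \ S) (hy : y ∈ connectedComponentIn (U \ S) c) :
      0 < g c * g y := by
    have hyU := connectedComponentIn_subset _ _ hy
    have gy : g y ≠ 0 := fun h => hyU.2 ((hgS y hyU.1).2 h)
    have gc : g c ≠ 0 := fun h => hc.2 ((hgS c hc.1).2 h)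
    by_contra! hle
    have hcont : ContinuousOn g (connectedComponentIn (U \ S) c) :=
      hgc.mono fun z hz => (connectedComponentIn_subset _ _ hz).1
    have hoc := (isPreconnected_connectedComponentIn.image g hcont).ordConnected
    have hzero : (0 : ℝ) ∈ g '' connectedComponentIn (U \ S) c := by
      refine hoc.uIcc_subset (mem_image_of_mem g (mem_connectedComponentIn hc))
        (mem_image_of_mem g hy) ?_
      rcases mul_nonpos_iff.1 hle with h | h
      · exact mem_uIcc.2 (.inr ⟨h.2, h.1⟩)
      · exact mem_uIcc.2 (.inl h)
    obtain ⟨z, hz, hz0⟩ := hzero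
    have hzU := connectedComponentIn_subset _ _ hz
    exact hzU.2 ((hgS z hzU.1).2 hz0)
  have gb : g b ≠ 0 := fun h => hb.2 ((hgS b hb.1).2 h)
  have hneg : g a * g b < 0 := by
    refine lt_of_le_of_ne (not_lt.1 fun h => hab ?_) (mul_ne_zero ga gb)
    exact comp (g a) ha.1 hb.1 (mul_self_pos.2 ga) h
  -- The factor `g b` makes the side of b the positive one.
  refine ⟨fun y => g b * g y, continuousOn_const.mul hgc, fun y hy => ?_, fun y hy => ?_,
    fun y hy => sign hb hy⟩
  · rw [hgS y hy]; simp [gb]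
  · have := sign ha hy
    by_contra! h
    have h3 : 0 < (g a * g y) * (g b * g b) := mul_pos this (mul_self_pos.2 gb)
    nlinarith

/-! ### Cross-sections and persistence of hits -/

/-- A closed set, met by every orbit in the future and in the past, that is crossed by the flow
from one side to the other at each of its points, with locally positive gaps between crossings. -/
structure IsCrossSection {X : Type*} [TopologicalSpace X] (Φ : Flow ℝ X) (S : Set X) : Prop where
  isClosed : IsClosed S
  crossing : ∀ x ∈ S, ∃ U : Set X, IsOpen U ∧ x ∈ U ∧ ∃ g : X → ℝ, ContinuousOn g U ∧
    (∀ y ∈ U, y ∈ S ↔ g y = 0) ∧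
    ∃ ε > 0, (∀ t ∈ Ioc 0 ε, 0 < g (Φ t x)) ∧ ∀ t ∈ Ico (-ε) 0, g (Φ t x) < 0
  separated : ∀ x ∈ S, ∃ δ > 0, ∀ᶠ y in 𝓝 x, y ∈ S → ∀ t, t ≠ 0 → |t| ≤ δ → Φ t y ∉ S
  hits_pos : ∀ x, ∃ t > 0, Φ t x ∈ S
  hits_neg : ∀ x, ∃ t < 0, Φ t x ∈ S

/-- Lying in different components becomes having opposite signs of g. The gap holds because an orbit
starting at y in S stays in U \ S at nonzero times between `δm y` and `δp y`, bounds that exceed δ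
in absolute value for y near x. -/
theorem IsGlobalPoincareSection.isCrossSection {X : Type*} [TopologicalSpace X] {n : ℕ}
    {Φ : Flow ℝ X} {S : Set X} (hS : IsGlobalPoincareSection n Φ S) : IsCrossSection Φ S where
  isClosed := hS.transversal.hypersurface.isClosed
  hits_pos x := (hS.hits x).1
  hits_neg x := (hS.hits x).2
  crossing x hx := by
    obtain ⟨δp, δm, h⟩ := hS.transversal.crossing
    obtain ⟨hp, hm, U, hU, hflat, ⟨a, ha, b, hb, hab, hca, hcb⟩, -, -⟩ := h x hx
    obtain ⟨g, hgc, hgS, hga, hgb⟩ := hflat.exists_signed_function ha hb hab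
    refine ⟨interior U, isOpen_interior, mem_interior_iff_mem_nhds.2 hU, g,
      hgc.mono interior_subset, fun y hy => hgS y (interior_subset hy), min (δp x) (-δm x),
      lt_min hp (by linarith), fun t ht => hgb _ (hcb t ⟨ht.1, ht.2.trans (min_le_left _ _)⟩),
      fun t ht => hga _ (hca t ⟨?_, ht.2⟩)⟩
    linarith [ht.1, min_le_right (δp x) (-δm x)]
  separated x hx := by
    obtain ⟨δp, δm, h⟩ := hS.transversal.crossing
    obtain ⟨-, -, -, -, -, -, -, V, hV, -, δ, hδ, hb⟩ := h x hx
    refine ⟨δ, hδ, Filter.mem_of_superset hV fun y hy hyS t ht0 htδ => ?_⟩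
    obtain ⟨-, -, U, -, -, ⟨a, ha, b, hb', -, hca, hcb⟩, -, -⟩ := h y hyS
    obtain ⟨h1, h2⟩ := hb y ⟨hy, hyS⟩
    obtain ⟨h3, h4⟩ := abs_le.1 htδ
    rcases ht0.lt_or_gt with ht | ht
    · exact (connectedComponentIn_subset _ _ (hca t ⟨by linarith, ht⟩)).2
    · exact (connectedComponentIn_subset _ _ (hcb t ⟨ht, by linarith⟩)).2

namespace IsCrossSection

variable {X : Type*} [TopologicalSpace X] {Φ : Flow ℝ X} {S : Set X}

/-- Time reversal exchanges the two sides, so g is replaced by -g. Backward statements then follow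
from forward ones. -/
theorem reverse (h : IsCrossSection Φ S) : IsCrossSection Φ.reverse S where
  isClosed := h.isClosed
  crossing x hx := by
    obtain ⟨U, hU, hxU, g, hgc, hgS, ε, hε, hp, hm⟩ := h.crossing x hx
    refine ⟨U, hU, hxU, fun y => -g y, hgc.neg, fun y hy => by simp [hgS y hy], ε, hε,
      fun t ht => ?_, fun t ht => ?_⟩
    · exact neg_pos.2 (hm (-t) ⟨neg_le_neg ht.2, neg_neg_iff_pos.2 ht.1⟩)
    · exact neg_neg_iff_pos.2 (hp (-t) ⟨neg_pos.2 ht.2, neg_le.1 ht.1⟩)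
  separated x hx := by
    obtain ⟨δ, hδ, hev⟩ := h.separated x hx
    exact ⟨δ, hδ, hev.mono fun y hy hyS t ht htδ =>
      hy hyS (-t) (neg_ne_zero.2 ht) (by rwa [abs_neg])⟩
  hits_pos x := by
    obtain ⟨t, ht, hS⟩ := h.hits_neg x
    exact ⟨-t, neg_pos.2 ht, by simpa using hS⟩
  hits_neg x := by
    obtain ⟨t, ht, hS⟩ := h.hits_pos x
    exact ⟨-t, neg_neg_iff_pos.2 ht, by simpa using hS⟩

/-- At times s and -s the function g has opposite strict signs along the orbit of x, hence along
nearby orbits; the intermediate value theorem gives a zero in between. -/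
theorem eventually_exists_hit_of_mem (h : IsCrossSection Φ S) {x : X} (hx : x ∈ S) {ε : ℝ}
    (hε : 0 < ε) : ∀ᶠ z in 𝓝 x, ∃ t ∈ Ioo (-ε) ε, Φ t z ∈ S := by
  obtain ⟨U, hU, hxU, g, hgc, hgS, ε₀, hε₀, hp, hm⟩ := h.crossing x hx
  have hcont : Continuous fun q : ℝ × X => Φ q.1 q.2 := by fun_prop
  have hmem : ∀ᶠ q : ℝ × X in 𝓝 ((0 : ℝ), x), Φ q.1 q.2 ∈ U :=
    hcont.continuousAt.eventually_mem (by simpa using hU.mem_nhds hxU)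
  rw [nhds_prod_eq] at hmem
  obtain ⟨p, hp', q, hq, hpq⟩ := Filter.eventually_prod_iff.1 hmem
  obtain ⟨ε₁, hε₁, hball⟩ := Metric.eventually_nhds_iff.1 hp'
  -- The time s must respect the requested precision ε, the sign condition up to ε₀, and the bound
  -- ε₁ that keeps orbits in U.
  obtain ⟨s, hs, hlt⟩ := exists_between (lt_min hε (lt_min hε₀ hε₁))
  obtain ⟨hsε, hs0, hs1⟩ : s < ε ∧ s < ε₀ ∧ s < ε₁ := by simpa using hlt
  have hpt {t : ℝ} (ht : |t| ≤ s) : p t := hball (by simpa using ht.trans_lt hs1)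
  have hgt {t : ℝ} (ht : |t| ≤ s) : Filter.Tendsto (fun z => g (Φ t z)) (𝓝 x) (𝓝 (g (Φ t x))) :=
    ((hgc.continuousAt (hU.mem_nhds (hpq (hpt ht) hq.self_of_nhds))).tendsto).comp
      (Φ.continuous_toFun t).continuousAt
  have e1 := (hgt (abs_of_pos hs).le).eventually_const_lt (hp s ⟨hs, hs0.le⟩)
  have e2 := (hgt (t := -s) (by rw [abs_neg, abs_of_pos hs])).eventually_lt_const
    (hm (-s) ⟨by linarith, by linarith⟩)
  filter_upwards [e1, e2, hq] with z h1 h2 hz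
  have hin (t : ℝ) (ht : t ∈ Icc (-s) s) : Φ t z ∈ U := hpq (hpt (abs_le.2 ht)) hz
  have hc : ContinuousOn (fun t => g (Φ t z)) (Icc (-s) s) :=
    hgc.comp (f := fun t => Φ t z) (by fun_prop) hin
  obtain ⟨t, ht, ht0⟩ := intermediate_value_Icc (by linarith) hc ⟨h2.le, h1.le⟩
  exact ⟨t, ⟨by linarith [ht.1], by linarith [ht.2]⟩, (hgS _ (hin t ht)).2 ht0⟩

theorem eventually_exists_hit (h : IsCrossSection Φ S) {x : X} {t₀ : ℝ} (hx : Φ t₀ x ∈ S) {ε : ℝ}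
    (hε : 0 < ε) : ∀ᶠ z in 𝓝 x, ∃ t ∈ Ioo (t₀ - ε) (t₀ + ε), Φ t z ∈ S := by
  filter_upwards [(Φ.continuous_toFun t₀).continuousAt.eventually
    (h.eventually_exists_hit_of_mem hx hε)] with z ⟨t, ht, htS⟩
  exact ⟨t + t₀, ⟨by linarith [ht.1], by linarith [ht.2]⟩, by rwa [Φ.map_add]⟩

end IsCrossSection

/-! ### Return time and Poincaré map -/

/-- The first positive time at which the orbit of `x` is in `S`. -/
noncomputable def returnTime {X : Type*} [TopologicalSpace X] (Φ : Flow ℝ X) (S : Set X)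
    (x : X) : ℝ :=
  sInf {t | 0 < t ∧ Φ t x ∈ S}

namespace IsCrossSection

variable {X : Type*} [TopologicalSpace X] {Φ : Flow ℝ X} {S : Set X}

theorem isLeast_returnTime (h : IsCrossSection Φ S) {x : X} (hx : x ∈ S) :
    IsLeast {t : ℝ | 0 < t ∧ Φ t x ∈ S} (returnTime Φ S x) := by
  obtain ⟨δ, hδ, hev⟩ := h.separated x hx
  -- The gap δ replaces the open condition 0 < t by δ ≤ t, so the set is closed and its infimum is
  -- attained.
  have heq : {t : ℝ | 0 < t ∧ Φ t x ∈ S} = Ici δ ∩ (fun t => Φ t x) ⁻¹' S := by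
    ext t
    refine ⟨fun ⟨h0, hS⟩ => ⟨?_, hS⟩, fun ⟨h0, hS⟩ => ⟨hδ.trans_le h0, hS⟩⟩
    by_contra hlt
    exact hev.self_of_nhds hx t h0.ne' (by rw [abs_of_pos h0]; exact (not_le.1 hlt).le) hS
  refine IsClosed.isLeast_csInf ?_ (h.hits_pos x) ⟨0, fun t ht => ht.1.le⟩
  rw [heq]
  exact isClosed_Ici.inter (h.isClosed.preimage (by fun_prop))

theorem returnTime_pos (h : IsCrossSection Φ S) {x : X} (hx : x ∈ S) : 0 < returnTime Φ S x :=
  (h.isLeast_returnTime hx).1.1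

theorem flow_returnTime_mem (h : IsCrossSection Φ S) {x : X} (hx : x ∈ S) :
    Φ (returnTime Φ S x) x ∈ S :=
  (h.isLeast_returnTime hx).1.2

theorem returnTime_le (h : IsCrossSection Φ S) {x : X} (hx : x ∈ S) {t : ℝ} (ht : 0 < t)
    (htS : Φ t x ∈ S) : returnTime Φ S x ≤ t :=
  (h.isLeast_returnTime hx).2 ⟨ht, htS⟩

/-- For a < T(x), nearby orbits miss S during the compact interval [δ, a], and the gap excludes
returns up to δ. For a > T(x), the hit at time T(x) persists before time a. -/
theorem continuousOn_returnTime (h : IsCrossSection Φ S) : ContinuousOn (returnTime Φ S) S := by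
  intro x hx
  refine tendsto_order.2 ⟨fun a ha => ?_, fun a ha => ?_⟩
  · obtain ⟨δ, hδ, hev⟩ := h.separated x hx
    have hK : ∀ᶠ y in 𝓝 x, ∀ t ∈ Icc δ a, Φ t y ∉ S := by
      refine isCompact_Icc.eventually_forall_of_forall_eventually fun t ht => ?_
      have hc : Continuous fun q : X × ℝ => Φ q.2 q.1 := by fun_prop
      refine hc.continuousAt.eventually (h.isClosed.isOpen_compl.mem_nhds fun htS => ?_)
      exact (h.returnTime_le hx (hδ.trans_le ht.1) htS).not_gt (ht.2.trans_lt ha)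
    filter_upwards [nhdsWithin_le_nhds hev, nhdsWithin_le_nhds hK, self_mem_nhdsWithin]
      with y hy hyK hyS
    have hpos := h.returnTime_pos hyS
    have hmem := h.flow_returnTime_mem hyS
    by_contra! hle
    refine hyK _ ⟨?_, hle⟩ hmem
    by_contra! hlt
    exact hy hyS _ hpos.ne' (by rw [abs_of_pos hpos]; exact hlt.le) hmem
  · have hpos := h.returnTime_pos hx
    filter_upwards [nhdsWithin_le_nhds (h.eventually_exists_hit (h.flow_returnTime_mem hx)
      (lt_min hpos (sub_pos.2 ha))), self_mem_nhdsWithin] with y ⟨t, ht, htS⟩ hyS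
    have h1 := min_le_left (returnTime Φ S x) (a - returnTime Φ S x)
    have h2 := min_le_right (returnTime Φ S x) (a - returnTime Φ S x)
    exact (h.returnTime_le hyS (by linarith [ht.1]) htS).trans_lt (by linarith [ht.2])

theorem continuous_returnTime (h : IsCrossSection Φ S) :
    Continuous fun x : S => returnTime Φ S x :=
  continuousOn_iff_continuous_domRestrict.1 h.continuousOn_returnTime

/-- A backward return after a time t < T(x) would be a forward return of x at time T(x) - t. -/
theorem returnTime_reverse (h : IsCrossSection Φ S) {x : X} (hx : x ∈ S) :
    returnTime Φ.reverse S (Φ (returnTime Φ S x) x) = returnTime Φ S x := by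
  refine (h.reverse.isLeast_returnTime (h.flow_returnTime_mem hx)).unique
    ⟨⟨h.returnTime_pos hx, by simpa [← Φ.map_add] using hx⟩, fun t ⟨ht, htS⟩ => ?_⟩
  by_contra! hlt
  rw [Flow.reverse_apply, ← Φ.map_add] at htS
  linarith [h.returnTime_le hx (by linarith) htS]

theorem returnTime_of_reverse (h : IsCrossSection Φ S) {x : X} (hx : x ∈ S) :
    returnTime Φ S (Φ (-returnTime Φ.reverse S x) x) = returnTime Φ.reverse S x := by
  have hrr : Φ.reverse.reverse = Φ := Flow.ext fun t x => by simp
  simpa [hrr] using h.reverse.returnTime_reverse hx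

/-- The Poincaré map of a cross-section. -/
noncomputable def poincareHomeomorph (h : IsCrossSection Φ S) : S ≃ₜ S where
  toFun x := ⟨Φ (returnTime Φ S x) x, h.flow_returnTime_mem x.2⟩
  invFun x := ⟨Φ (-returnTime Φ.reverse S x) x, h.reverse.flow_returnTime_mem x.2⟩
  left_inv x := Subtype.ext <| by simp [h.returnTime_reverse x.2, ← Φ.map_add]
  right_inv x := Subtype.ext <| by simp [h.returnTime_of_reverse x.2, ← Φ.map_add]
  continuous_toFun := (Φ.continuous h.continuous_returnTime continuous_subtype_val).subtype_mk _
  continuous_invFun :=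
    (Φ.continuous h.reverse.continuous_returnTime.neg continuous_subtype_val).subtype_mk _

theorem coe_poincareHomeomorph (h : IsCrossSection Φ S) (x : S) :
    (h.poincareHomeomorph x : X) = Φ (returnTime Φ S x) x :=
  rfl

theorem isPoincareMap (h : IsCrossSection Φ S) : IsPoincareMap Φ S h.poincareHomeomorph :=
  fun x => ⟨returnTime Φ S x, h.isLeast_returnTime x.2, rfl⟩

end IsCrossSection

/-! ### The mapping torus as the phase space -/

namespace IsCrossSection

variable {X : Type*} [TopologicalSpace X] {Φ : Flow ℝ X} {S : Set X}

/-- The map sending `(x, t)` to the point of the orbit of `x` at the fraction `t` of its way back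
to the section. -/
noncomputable def sweep (Φ : Flow ℝ X) (S : Set X) (p : S × unitInterval) : X :=
  Φ (p.2 * returnTime Φ S p.1) p.1

theorem continuous_sweep (h : IsCrossSection Φ S) : Continuous (sweep Φ S) := by
  have := h.continuous_returnTime.comp (continuous_fst (X := S) (Y := unitInterval))
  exact Φ.continuous ((continuous_subtype_val.comp continuous_snd).mul this)
    (continuous_subtype_val.comp continuous_fst)

/-- If the images converge to y, the elapsed times s stay bounded, so they converge along the
ultrafilter to some s₀. The base points then converge to Φ(-s₀, y), which is in S because S is
closed; as T is continuous and positive there, the fractions s / T converge too. -/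
theorem isProperMap_sweep (h : IsCrossSection Φ S) : IsProperMap (sweep Φ S) := by
  refine isProperMap_iff_ultrafilter.2 ⟨h.continuous_sweep, fun 𝒰 y hy => ?_⟩
  obtain ⟨t₀, ht₀, ht₀S⟩ := h.hits_neg y
  let s : S × unitInterval → ℝ := fun p => p.2 * returnTime Φ S p.1
  -- Points near y have a hit at some time in (2t₀, 0). If s exceeded -2t₀, this would be a return
  -- of the base point before time s ≤ T.
  have hs : ∀ᶠ p in (𝒰 : Filter (S × unitInterval)), s p ∈ Icc 0 (-(2 * t₀)) := by
    filter_upwards [hy.eventually (h.eventually_exists_hit ht₀S (neg_pos.2 ht₀))]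
      with p ⟨t, ht, htS⟩
    have hT := h.returnTime_pos p.1.2
    have hsT : s p ≤ returnTime Φ S p.1 := mul_le_of_le_one_left hT.le p.2.2.2
    refine ⟨mul_nonneg p.2.2.1 hT.le, ?_⟩
    by_contra! hlt
    change Φ t (Φ (s p) p.1) ∈ S at htS
    rw [← Φ.map_add] at htS
    linarith [h.returnTime_le p.1.2 (by linarith [ht.1]) htS, ht.2]
  obtain ⟨s₀, -, hs₀⟩ := isCompact_Icc.ultrafilter_le_nhds (𝒰.map s) (Filter.le_principal_iff.2 hs)
  have hs₀ : Filter.Tendsto s 𝒰 (𝓝 s₀) := hs₀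
  have hx : Filter.Tendsto (fun p : S × unitInterval => (p.1 : X)) 𝒰 (𝓝 (Φ (-s₀) y)) := by
    have hc : Continuous fun q : ℝ × X => Φ (-q.1) q.2 := by fun_prop
    refine ((hc.tendsto (s₀, y)).comp (hs₀.prodMk_nhds hy)).congr fun p => ?_
    simp [sweep, s, ← Φ.map_add]
  have hmem : Φ (-s₀) y ∈ S := h.isClosed.mem_of_tendsto hx (.of_forall fun p => p.1.2)
  have hx' : Filter.Tendsto (fun p : S × unitInterval => p.1) 𝒰 (𝓝 ⟨Φ (-s₀) y, hmem⟩) :=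
    tendsto_subtype_rng.2 hx
  have hT := (h.continuous_returnTime.tendsto _).comp hx'
  have hT₀ := h.returnTime_pos hmem
  have hr : Filter.Tendsto (fun p : S × unitInterval => (p.2 : ℝ)) 𝒰
      (𝓝 (s₀ / returnTime Φ S (Φ (-s₀) y))) := by
    refine (hs₀.div hT hT₀.ne').congr fun p => ?_
    exact mul_div_cancel_right₀ _ (h.returnTime_pos p.1.2).ne'
  have hr₀ := isClosed_Icc.mem_of_tendsto hr (.of_forall fun p => p.2.2)
  refine ⟨(⟨Φ (-s₀) y, hmem⟩, ⟨_, hr₀⟩), ?_, ?_⟩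
  · simp [sweep, div_mul_cancel₀ _ hT₀.ne', ← Φ.map_add]
  · exact hx'.prodMk_nhds (tendsto_subtype_rng.2 hr)

theorem sweep_surjective (h : IsCrossSection Φ S) : Function.Surjective (sweep Φ S) := by
  intro y
  obtain ⟨t₀, ht₀, ht₀S⟩ := h.hits_neg y
  have hclosed : IsClosed (Ici 0 ∩ (fun t : ℝ => Φ (-t) y) ⁻¹' S) :=
    isClosed_Ici.inter (h.isClosed.preimage (by fun_prop))
  obtain ⟨⟨hs0, hsS⟩, hmin⟩ := hclosed.isLeast_csInf
    ⟨-t₀, by simpa using ht₀.le, by simpa using ht₀S⟩ ⟨0, fun t ht => ht.1⟩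
  -- Going back by s reaches the latest visit to S, at or before y; minimality of s prevents a
  -- return in between.
  set s := sInf (Ici 0 ∩ (fun t : ℝ => Φ (-t) y) ⁻¹' S)
  have hT := h.returnTime_pos hsS
  have hle : s ≤ returnTime Φ S (Φ (-s) y) := by
    by_contra! hlt
    have := h.flow_returnTime_mem hsS
    rw [← Φ.map_add] at this
    have := hmin (a := s - returnTime Φ S (Φ (-s) y))
      ⟨by simpa using hlt.le, by simpa [neg_sub, sub_eq_add_neg] using this⟩
    linarith
  refine ⟨(⟨Φ (-s) y, hsS⟩, ⟨s / returnTime Φ S (Φ (-s) y), div_nonneg hs0 hT.le,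
    div_le_one_of_le₀ hle hT.le⟩), ?_⟩
  simp [sweep, div_mul_cancel₀ _ hT.ne', ← Φ.map_add]

/-- The map from the mapping torus of the Poincaré map to the phase space. -/
noncomputable def torusMap (h : IsCrossSection Φ S) : MappingTorus h.poincareHomeomorph → X :=
  Quot.lift (sweep Φ S) <| by
    rintro ⟨x, t⟩ q ⟨ht, rfl⟩
    obtain rfl : t = 1 := ht
    simp [sweep, h.coe_poincareHomeomorph]

theorem torusMap_mk (h : IsCrossSection Φ S) (p : S × unitInterval) :
    h.torusMap (MappingTorus.mk _ p) = Φ (p.2 * returnTime Φ S p.1) p.1 :=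
  rfl

theorem _root_.MappingTorus.exists_mk_lt_one {f : X ≃ₜ X} (p : MappingTorus f) :
    ∃ q : X × unitInterval, q.2 < 1 ∧ MappingTorus.mk f q = p := by
  induction p using Quot.ind with
  | mk p =>
    rcases p.2.2.2.lt_or_eq with hp | hp
    · exact ⟨p, hp, rfl⟩
    · refine ⟨(f p.1, 0), by simp, ?_⟩
      rw [← MappingTorus.mk_one, show (1 : unitInterval) = p.2 from Subtype.ext hp.symm]
      rfl

/-- With fractions below 1, if two arcs met at different elapsed times, the base point of one would
be a return of the other's base point before its first return. -/
theorem torusMap_injective (h : IsCrossSection Φ S) : Function.Injective h.torusMap := by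
  have key (x y : S) (s t : ℝ) (hs : 0 ≤ s) (ht : t < returnTime Φ S y) (hst : s ≤ t)
      (heq : Φ s x = Φ t y) : x = y ∧ s = t := by
    have hx : (x : X) = Φ (t - s) y := by
      rw [sub_eq_neg_add, Φ.map_add, ← heq, ← Φ.map_add]
      simp
    obtain rfl : s = t := by
      by_contra hne
      have := h.returnTime_le y.2 (sub_pos.2 (lt_of_le_of_ne hst hne)) (hx ▸ x.2)
      linarith
    exact ⟨Subtype.ext (by simpa using hx), rfl⟩
  intro p q hpq
  obtain ⟨⟨x, s⟩, hs, rfl⟩ := p.exists_mk_lt_one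
  obtain ⟨⟨y, t⟩, ht, rfl⟩ := q.exists_mk_lt_one
  have hx := h.returnTime_pos x.2
  have hy := h.returnTime_pos y.2
  simp only [torusMap_mk] at hpq
  have hs' : (s : ℝ) * returnTime Φ S x < returnTime Φ S x :=
    mul_lt_of_lt_one_left hx (by exact_mod_cast hs)
  have ht' : (t : ℝ) * returnTime Φ S y < returnTime Φ S y :=
    mul_lt_of_lt_one_left hy (by exact_mod_cast ht)
  have hs0 := mul_nonneg s.2.1 hx.le
  have ht0 := mul_nonneg t.2.1 hy.le
  have : x = y ∧ (s : ℝ) * returnTime Φ S x = t * returnTime Φ S y := by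
    rcases le_total ((s : ℝ) * returnTime Φ S x) (t * returnTime Φ S y) with hle | hle
    · exact key x y _ _ hs0 ht' hle hpq
    · obtain ⟨h1, h2⟩ := key y x _ _ ht0 hs' hle hpq.symm
      exact ⟨h1.symm, h2.symm⟩
  obtain ⟨rfl, h2⟩ := this
  rw [Subtype.ext (mul_right_cancel₀ hx.ne' h2)]

/-- The mapping torus of the Poincaré map is homeomorphic to the phase space. -/
noncomputable def torusHomeomorph (h : IsCrossSection Φ S) :
    MappingTorus h.poincareHomeomorph ≃ₜ X :=
  (Equiv.ofBijective h.torusMap ⟨h.torusMap_injective, fun y => by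
    obtain ⟨p, hp⟩ := h.sweep_surjective y
    exact ⟨MappingTorus.mk _ p, hp⟩⟩).toHomeomorphOfContinuousClosed
    (continuous_quot_lift _ h.continuous_sweep) fun C hC => by
      -- The image of C is the image under `sweep` of the preimage of C in S × [0, 1].
      convert h.isProperMap_sweep.isClosedMap _
        (hC.preimage (MappingTorus.isQuotientMap_mk h.poincareHomeomorph).continuous) using 1
      rw [← image_preimage_eq C (MappingTorus.isQuotientMap_mk _).surjective, image_image,
        image_preimage_eq C (MappingTorus.isQuotientMap_mk _).surjective]
      rfl

theorem torusHomeomorph_mk (h : IsCrossSection Φ S) (p : S × unitInterval) :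
    h.torusHomeomorph (MappingTorus.mk _ p) = Φ (p.2 * returnTime Φ S p.1) p.1 :=
  rfl

theorem torusHomeomorph_preimage (h : IsCrossSection Φ S) :
    h.torusHomeomorph ⁻¹' S = MappingTorus.zeroSection h.poincareHomeomorph := by
  ext p
  constructor
  · intro hp
    refine ⟨⟨_, hp⟩, h.torusHomeomorph.injective ?_⟩
    simp [torusHomeomorph_mk]
  · rintro ⟨x, rfl⟩
    simp [torusHomeomorph_mk]

end IsCrossSection

theorem IsTopologicalManifold.of_homeomorph {X Y : Type*} [TopologicalSpace X]
    [TopologicalSpace Y] {n : ℕ} (hX : IsTopologicalManifold n X) (e : X ≃ₜ Y) :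
    IsTopologicalManifold n Y where
  t2 := have := hX.t2; e.t2Space
  secondCountable := have := hX.secondCountable; e.symm.secondCountableTopology
  locallyEuclidean := by
    obtain ⟨c⟩ := hX.locallyEuclidean
    exact ⟨e.chartedSpace⟩

/-! ### Hit times and the time change -/

namespace IsCrossSection

variable {X : Type*} [TopologicalSpace X] {Φ : Flow ℝ X} {S : Set X}

/-- The skew product `(x, r) ↦ (f x, r + T x)` of the Poincaré map with the return time. -/
noncomputable def skewProduct (h : IsCrossSection Φ S) : Equiv.Perm (S × ℝ) where
  toFun p := (h.poincareHomeomorph p.1, p.2 + returnTime Φ S p.1)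
  invFun p := (h.poincareHomeomorph.symm p.1,
    p.2 - returnTime Φ S (h.poincareHomeomorph.symm p.1))
  left_inv p := by simp
  right_inv p := by simp

/-- The time at which the orbit of `x` meets the section for the `n`-th time. -/
noncomputable def hitTime (h : IsCrossSection Φ S) (n : ℤ) (x : S) : ℝ :=
  ((h.skewProduct ^ n) (x, 0)).2

/-- The skew product commutes with translations of the second coordinate, so its powers are
determined by r = 0. Group powers thus yield the cocycle of hit times for all integers at once. -/
theorem skewProduct_zpow (h : IsCrossSection Φ S) (n : ℤ) (x : S) (r : ℝ) :
    (h.skewProduct ^ n) (x, r) = ((h.poincareHomeomorph ^ n) x, r + h.hitTime n x) := by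
  unfold hitTime
  induction n generalizing x r with
  | zero => simp
  | succ n ih =>
    have hstep (r : ℝ) : (h.skewProduct ^ ((n : ℤ) + 1)) (x, r) =
        h.skewProduct ((h.skewProduct ^ (n : ℤ)) (x, r)) := by
      rw [add_comm, zpow_add, zpow_one, Equiv.Perm.mul_apply]
    have hf : (h.poincareHomeomorph ^ ((n : ℤ) + 1)) x =
        h.poincareHomeomorph ((h.poincareHomeomorph ^ (n : ℤ)) x) := by
      rw [add_comm, zpow_add, zpow_one]; rfl
    rw [hstep, hstep, ih, ih x 0, hf]
    simp [skewProduct, add_assoc]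
  | pred n ih =>
    have hstep (r : ℝ) : (h.skewProduct ^ (-(n : ℤ) - 1)) (x, r) =
        h.skewProduct.symm ((h.skewProduct ^ (-(n : ℤ))) (x, r)) := by
      rw [sub_eq_neg_add, zpow_add, zpow_neg_one, Equiv.Perm.mul_apply]; rfl
    have hf : (h.poincareHomeomorph ^ (-(n : ℤ) - 1)) x =
        h.poincareHomeomorph.symm ((h.poincareHomeomorph ^ (-(n : ℤ))) x) := by
      rw [sub_eq_neg_add, zpow_add, zpow_neg_one]; rfl
    rw [hstep, hstep, ih, ih x 0, hf]
    simp [skewProduct, add_sub_assoc]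

theorem hitTime_zero (h : IsCrossSection Φ S) (x : S) : h.hitTime 0 x = 0 := by
  simp [hitTime]

theorem hitTime_add_one (h : IsCrossSection Φ S) (n : ℤ) (x : S) :
    h.hitTime (n + 1) x = h.hitTime n x + returnTime Φ S ((h.poincareHomeomorph ^ n) x) := by
  rw [hitTime, add_comm n, zpow_add, zpow_one, Equiv.Perm.mul_apply, skewProduct_zpow]
  simp [skewProduct]

/-- Here the first return is split off instead of the last, as the gluing (x, 1) ∼ (f x, 0)
requires. -/
theorem hitTime_add_one' (h : IsCrossSection Φ S) (n : ℤ) (x : S) :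
    h.hitTime (n + 1) x = returnTime Φ S x + h.hitTime n (h.poincareHomeomorph x) := by
  rw [hitTime, zpow_add, zpow_one, Equiv.Perm.mul_apply]
  change ((h.skewProduct ^ n) (h.poincareHomeomorph x, 0 + returnTime Φ S x)).2 = _
  rw [skewProduct_zpow, zero_add]

theorem flow_hitTime (h : IsCrossSection Φ S) (n : ℤ) (x : S) :
    Φ (h.hitTime n x) x = (h.poincareHomeomorph ^ n) x := by
  -- Time maps of the flow are injective, so the step is an equivalence and serves both directions
  -- of the induction.
  have step (n : ℤ) : Φ (h.hitTime (n + 1) x) x = (h.poincareHomeomorph ^ (n + 1)) x ↔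
      Φ (h.hitTime n x) x = (h.poincareHomeomorph ^ n) x := by
    have hf : (h.poincareHomeomorph ^ (n + 1)) x =
        h.poincareHomeomorph ((h.poincareHomeomorph ^ n) x) := by
      rw [add_comm, zpow_add, zpow_one]; rfl
    rw [hitTime_add_one, add_comm, Φ.map_add, hf, coe_poincareHomeomorph]
    exact (Φ.toHomeomorph _).injective.eq_iff
  induction n with
  | zero => simp [hitTime_zero]
  | succ n ih => exact (step _).2 ih
  | pred n ih => exact (step _).1 (by simpa using ih)

theorem hitTime_strictMono (h : IsCrossSection Φ S) (x : S) :
    StrictMono fun n => h.hitTime n x := by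
  refine strictMono_int_of_lt_succ fun n => ?_
  rw [hitTime_add_one]
  linarith [h.returnTime_pos ((h.poincareHomeomorph ^ n) x).2]

/-- If consecutive hit times shared the limit l, the hit points would converge to Φ(l, x) in S and
the gaps to T there, which is positive; but the gaps tend to 0. -/
theorem not_tendsto_hitTime (h : IsCrossSection Φ S) (x : S) {ι : Type*} {F : Filter ι} [F.NeBot]
    {u : ι → ℤ} {l : ℝ} (h₁ : Tendsto (fun i => h.hitTime (u i) x) F (𝓝 l))
    (h₂ : Tendsto (fun i => h.hitTime (u i + 1) x) F (𝓝 l)) : False := by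
  have hy : Tendsto (fun i => ((h.poincareHomeomorph ^ u i) x : X)) F (𝓝 (Φ l x)) := by
    simp only [← flow_hitTime]
    have hc : Continuous fun t => Φ t (x : X) := by fun_prop
    exact (hc.tendsto l).comp h₁
  have hmem : Φ l x ∈ S := h.isClosed.mem_of_tendsto hy (.of_forall fun i => Subtype.prop _)
  have hT := (h.continuous_returnTime.tendsto ⟨Φ l x, hmem⟩).comp (tendsto_subtype_rng.2 hy)
  have h0 : Tendsto (fun i => h.hitTime (u i + 1) x - h.hitTime (u i) x) F (𝓝 (l - l)) := h₂.sub h₁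
  simp only [hitTime_add_one, add_sub_cancel_left, sub_self] at h0
  exact (h.returnTime_pos hmem).ne' (tendsto_nhds_unique hT h0)

theorem tendsto_hitTime_atTop (h : IsCrossSection Φ S) (x : S) :
    Tendsto (fun n => h.hitTime n x) atTop atTop := by
  refine (tendsto_atTop_of_monotone (h.hitTime_strictMono x).monotone).resolve_right ?_
  rintro ⟨l, hl⟩
  exact h.not_tendsto_hitTime x hl (hl.comp (tendsto_atTop_add_const_right _ 1 tendsto_id))

theorem tendsto_hitTime_neg_atBot (h : IsCrossSection Φ S) (x : S) :
    Tendsto (fun n : ℤ => h.hitTime (-n) x) atTop atBot := by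
  refine (tendsto_atTop_of_antitone fun m n hmn =>
    (h.hitTime_strictMono x).monotone (neg_le_neg hmn)).resolve_right ?_
  rintro ⟨l, hl⟩
  refine h.not_tendsto_hitTime x (u := fun n => -(n + 1))
    (hl.comp (tendsto_atTop_add_const_right _ 1 tendsto_id)) (hl.congr fun n => ?_)
  congr 1
  ring

/-- The time needed along the orbit of `x` to make `u` turns of the mapping torus. -/
noncomputable def turnTime (h : IsCrossSection Φ S) (x : S) (u : ℝ) : ℝ :=
  h.hitTime ⌊u⌋ x + Int.fract u * returnTime Φ S ((h.poincareHomeomorph ^ ⌊u⌋) x)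

theorem turnTime_add_one (h : IsCrossSection Φ S) (x : S) (u : ℝ) :
    h.turnTime x (u + 1) = returnTime Φ S x + h.turnTime (h.poincareHomeomorph x) u := by
  have hf : (h.poincareHomeomorph ^ (⌊u⌋ + 1)) x =
      (h.poincareHomeomorph ^ ⌊u⌋) (h.poincareHomeomorph x) := by
    rw [zpow_add, zpow_one]; rfl
  rw [turnTime, turnTime, Int.floor_add_one, Int.fract_add_one, hitTime_add_one', hf, add_assoc]

theorem turnTime_coe (h : IsCrossSection Φ S) (x : S) (t : unitInterval) :
    h.turnTime x t = t * returnTime Φ S x := by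
  have h0 (y : S) : h.turnTime y 0 = 0 := by simp [turnTime, hitTime_zero]
  rcases t.2.2.lt_or_eq with ht | ht
  · have hfl : ⌊(t : ℝ)⌋ = 0 := Int.floor_eq_zero_iff.2 ⟨t.2.1, ht⟩
    have hfr : Int.fract (t : ℝ) = t := Int.fract_eq_self.2 ⟨t.2.1, ht⟩
    simp [turnTime, hfl, hfr, hitTime_zero]
  -- At t = 1 the floor has already jumped, so the value comes from a full turn.
  · have := h.turnTime_add_one x 0
    rw [ht]
    simpa [h0] using this

theorem turnTime_zero (h : IsCrossSection Φ S) (x : S) : h.turnTime x 0 = 0 := by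
  simpa using h.turnTime_coe x 0

/-- Going back t turns from x amounts to going forward 1 - t turns from the preceding section point,
less one full return time. -/
theorem turnTime_neg_coe (h : IsCrossSection Φ S) (x : S) (t : unitInterval) :
    h.turnTime x (-t) = -(t * returnTime Φ S (h.poincareHomeomorph.symm x)) := by
  have h1 := h.turnTime_add_one (h.poincareHomeomorph.symm x) (-t)
  have h2 := h.turnTime_coe (h.poincareHomeomorph.symm x) (unitInterval.symm t)
  rw [unitInterval.coe_symm_eq, sub_eq_neg_add, h1, Homeomorph.apply_symm_apply] at h2
  linarith

theorem turnTime_strictMono (h : IsCrossSection Φ S) (x : S) : StrictMono (h.turnTime x) := by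
  intro u v huv
  have hT := h.returnTime_pos ((h.poincareHomeomorph ^ ⌊u⌋) x).2
  rcases (Int.floor_mono huv.le).lt_or_eq with hlt | heq
  · have h1 : h.turnTime x u < h.hitTime (⌊u⌋ + 1) x := by
      rw [turnTime, hitTime_add_one]
      have := mul_lt_of_lt_one_left hT (Int.fract_lt_one u)
      linarith
    have h2 : h.hitTime (⌊u⌋ + 1) x ≤ h.hitTime ⌊v⌋ x := (h.hitTime_strictMono x).monotone hlt
    have h3 : h.hitTime ⌊v⌋ x ≤ h.turnTime x v :=
      le_add_of_nonneg_right (mul_nonneg (Int.fract_nonneg v) (h.returnTime_pos (Subtype.prop _)).le)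
    linarith
  · have hfr : Int.fract u < Int.fract v := by
      rw [Int.fract, Int.fract, heq]; linarith
    rw [turnTime, turnTime, ← heq]
    have := mul_lt_mul_of_pos_right hfr hT
    linarith

theorem turnTime_surjective (h : IsCrossSection Φ S) (x : S) :
    Function.Surjective (h.turnTime x) := by
  intro r
  obtain ⟨N, hN⟩ := ((h.tendsto_hitTime_atTop x).eventually_gt_atTop r).exists
  obtain ⟨M, hM⟩ := ((h.tendsto_hitTime_neg_atBot x).eventually_le_atBot r).exists
  -- The n-th hit is the last one at or before time r; it exists because hit times are unbounded in
  -- both directions.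
  obtain ⟨n, hn, hmax⟩ := Int.exists_greatest_of_bdd (P := fun n => h.hitTime n x ≤ r)
    ⟨N, fun z hz => ((h.hitTime_strictMono x).lt_iff_lt.1 (hz.trans_lt hN)).le⟩ ⟨-M, hM⟩
  have hlt : r < h.hitTime (n + 1) x := by
    by_contra! hle
    linarith [hmax _ hle]
  rw [hitTime_add_one] at hlt
  have hT := h.returnTime_pos ((h.poincareHomeomorph ^ n) x).2
  set T := returnTime Φ S ((h.poincareHomeomorph ^ n) x)
  have h0 : 0 ≤ (r - h.hitTime n x) / T := div_nonneg (sub_nonneg.2 hn) hT.le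
  have h1 : (r - h.hitTime n x) / T < 1 := (div_lt_one hT).2 (by linarith)
  refine ⟨n + (r - h.hitTime n x) / T, ?_⟩
  have hfl : ⌊(r - h.hitTime n x) / T⌋ = 0 := Int.floor_eq_zero_iff.2 ⟨h0, h1⟩
  rw [turnTime, Int.floor_intCast_add, Int.fract_intCast_add, Int.fract_eq_self.2 ⟨h0, h1⟩, hfl,
    add_zero, div_mul_cancel₀ _ hT.ne']
  ring

/-- For every real u, this matches u turns on the torus with the flow of Φ for time `turnTime`, and
so yields the conjugacy up to time change. -/
theorem torusHomeomorph_unroll (h : IsCrossSection Φ S) (x : S) (u : ℝ) :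
    h.torusHomeomorph (MappingTorus.unroll _ u x) = Φ (h.turnTime x u) x := by
  rw [MappingTorus.unroll, torusHomeomorph_mk, turnTime, add_comm, Φ.map_add, flow_hitTime]

end IsCrossSection

/-! ### The equivalence of flows -/

theorem StrictMono.isHomeomorph_of_surjective {α β : Type*} [LinearOrder α] [LinearOrder β]
    [TopologicalSpace α] [OrderTopology α] [TopologicalSpace β] [OrderTopology β] {g : α → β}
    (hg : StrictMono g) (hs : Function.Surjective g) : IsHomeomorph g :=
  (hg.orderIsoOfSurjective g hs).toHomeomorph.isHomeomorph

/-- The homeomorphism from the mapping torus to the phase space, as a weak morphism. -/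
noncomputable def IsCrossSection.weakMorphism {X : Type*} [TopologicalSpace X] {Φ : Flow ℝ X}
    {S : Set X} (h : IsCrossSection Φ S) :
    WeakMorphism (suspensionFlow h.poincareHomeomorph) Φ where
  toFun := h.torusHomeomorph
  -- The subtracted term is the time from [x, 0] to [x, t]. Replacing (x, 1) by (f x, 0) shifts both
  -- terms by T(x), so the difference is well defined.
  time := Quot.lift (fun p s => h.turnTime p.1 (s + p.2) - h.turnTime p.1 p.2) <| by
    rintro ⟨x, t⟩ q ⟨ht, rfl⟩
    obtain rfl : t = 1 := ht
    funext s
    have h1 := h.turnTime_add_one x s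
    have h2 := h.turnTime_add_one x 0
    rw [zero_add] at h2
    simp [h1, h2]
  continuous_toFun := h.torusHomeomorph.continuous
  map_flow p s := by
    induction p using Quot.ind with
    | mk p =>
      change h.torusHomeomorph (MappingTorus.unroll _ (s + p.2) p.1) =
        Φ (h.turnTime p.1 (s + p.2) - h.turnTime p.1 p.2) (Φ (p.2 * returnTime Φ S p.1) p.1)
      rw [h.torusHomeomorph_unroll, ← h.turnTime_coe, ← Φ.map_add, sub_add_cancel]
  time_strictMono p := by
    induction p using Quot.ind with
    | mk p => exact fun s t hst => sub_lt_sub_right (h.turnTime_strictMono _ (by simpa using hst)) _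
  time_isHomeomorph p := by
    induction p using Quot.ind with
    | mk p =>
      refine StrictMono.isHomeomorph_of_surjective
        (fun s t hst => sub_lt_sub_right (h.turnTime_strictMono _ (by simpa using hst)) _)
        fun r => ?_
      obtain ⟨u, hu⟩ := h.turnTime_surjective p.1 (r + h.turnTime p.1 p.2)
      exact ⟨u - p.2, by simp [hu]⟩
  time_zero p := by
    induction p using Quot.ind with
    | mk p =>
      change h.turnTime p.1 (0 + p.2) - h.turnTime p.1 p.2 = 0
      rw [zero_add, sub_self]

theorem IsCrossSection.weakMorphism_time_mk_zero {X : Type*} [TopologicalSpace X] {Φ : Flow ℝ X}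
    {S : Set X} (h : IsCrossSection Φ S) (x : S) (s : ℝ) :
    h.weakMorphism.time (MappingTorus.mk _ (x, 0)) s = h.turnTime x s := by
  change h.turnTime x (s + (0 : unitInterval)) - h.turnTime x (0 : unitInterval) = _
  simp [turnTime_zero]

/-- A weak morphism whose space part is a homeomorphism is a topological equivalence. -/
theorem WeakMorphism.topologicallyEquivalent {X Y : Type*} [TopologicalSpace X]
    [TopologicalSpace Y] {Φ : Flow ℝ X} {Ψ : Flow ℝ Y} (k : WeakMorphism Ψ Φ) (e : Y ≃ₜ X)
    (he : ∀ y, k.toFun y = e y) (S : Set X) :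
    TopologicallyEquivalent Φ S Ψ (e ⁻¹' S) := by
  let o (y : Y) : ℝ ≃o ℝ :=
    (k.time_strictMono y).orderIsoOfSurjective _ (k.time_isHomeomorph y).surjective
  have ho (y : Y) (t : ℝ) : k.time y ((o y).symm t) = t := (o y).apply_symm_apply t
  have ho' (y : Y) (t : ℝ) : (o y).symm (k.time y t) = t := (o y).symm_apply_apply t
  let h : WeakMorphism Φ Ψ :=
    { toFun := e.symm
      time := fun x => (o (e.symm x)).symm
      continuous_toFun := e.symm.continuous
      map_flow := fun x t => by
        apply e.injective
        rw [← he (Ψ _ _), k.map_flow, ho, he]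
        simp
      time_isHomeomorph := fun x => (o (e.symm x)).symm.toHomeomorph.isHomeomorph
      time_strictMono := fun x => (o (e.symm x)).symm.strictMono
      time_zero := fun x => by
        have := ho' (e.symm x) 0
        rwa [k.time_zero] at this }
  refine ⟨h, k, ?_, ?_, ?_, ?_⟩
  · ext x
    simp [h]
  · ext y
    simp [he]
  · ext x t
    · exact (he _).trans (e.apply_symm_apply x)
    · exact ho _ _
  · ext y t
    · exact (congrArg e.symm (he y)).trans (e.symm_apply_apply y)
    · change (o (e.symm (k.toFun y))).symm (k.time y t) = t
      rw [he, e.symm_apply_apply, ho']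

/-! ### Pulling back the Poincaré section -/

theorem IsFlatBall.preimage {X Y : Type*} [TopologicalSpace X] [TopologicalSpace Y] {n : ℕ}
    {S U : Set X} (hU : IsFlatBall n S U) (e : Y ≃ₜ X) : IsFlatBall n (e ⁻¹' S) (e ⁻¹' U) := by
  obtain ⟨φ, hφ⟩ := hU
  exact ⟨(e.subtype fun _ => Iff.rfl).trans φ, fun u => hφ ⟨e u, u.2⟩⟩

theorem Homeomorph.preimage_connectedComponentIn {X Y : Type*} [TopologicalSpace X]
    [TopologicalSpace Y] (e : Y ≃ₜ X) {F : Set X} {a : X} (ha : a ∈ F) :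
    connectedComponentIn (e ⁻¹' F) (e.symm a) = e ⁻¹' connectedComponentIn F a := by
  simpa only [e.image_symm] using (e.symm.image_connectedComponentIn ha).symm

/-- A global Poincaré section pulls back along a weak morphism whose space part is a homeomorphism
and whose time part grows, on the section, at a locally bounded rate. -/
theorem IsGlobalPoincareSection.preimage {X Y : Type*} [TopologicalSpace X] [TopologicalSpace Y]
    {n : ℕ} {Φ : Flow ℝ X} {Ψ : Flow ℝ Y} {S : Set X} (hS : IsGlobalPoincareSection n Φ S)
    (k : WeakMorphism Ψ Φ) (e : Y ≃ₜ X) (he : ∀ y, k.toFun y = e y)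
    (hk : ∀ y ∈ e ⁻¹' S, ∃ C > 0, ∀ᶠ z in 𝓝 y, z ∈ e ⁻¹' S → ∀ t ∈ Icc (0 : ℝ) 1,
      k.time z t ≤ t * C ∧ -(t * C) ≤ k.time z (-t)) :
    IsGlobalPoincareSection n Ψ (e ⁻¹' S) := by
  have hflow (y : Y) (t : ℝ) : e (Ψ t y) = Φ (k.time y t) (e y) := by
    rw [← he, k.map_flow, he]
  have hpos (y : Y) (t : ℝ) : 0 < k.time y t ↔ 0 < t := by
    rw [← (k.time_strictMono y).lt_iff_lt (b := t), k.time_zero]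
  have hneg (y : Y) (t : ℝ) : k.time y t < 0 ↔ t < 0 := by
    rw [← (k.time_strictMono y).lt_iff_lt (a := t), k.time_zero]
  have hsurj (y : Y) := (k.time_isHomeomorph y).surjective
  have hclosed : IsClosed (e ⁻¹' S) := hS.transversal.hypersurface.isClosed.preimage e.continuous
  refine ⟨⟨⟨hclosed, fun y hy => ?_⟩, ?_, fun y a b => ?_⟩, fun y => ⟨?_, ?_⟩⟩
  · obtain ⟨U, hU, hflat⟩ := hS.transversal.hypersurface.locallyFlat _ hy
    exact ⟨_, e.continuous.continuousAt.preimage_mem_nhds hU, hflat.preimage e⟩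
  · obtain ⟨δp, δm, hδ⟩ := hS.transversal.crossing
    -- The crossing times of Ψ are those of Φ read through the inverse of the time change.
    choose dp hdp using fun y => hsurj y (δp (e y))
    choose dm hdm using fun y => hsurj y (δm (e y))
    refine ⟨dp, dm, fun y hy => ?_⟩
    obtain ⟨hp, hm, U, hU, hflat, ⟨a, ha, b, hb, hab, hca, hcb⟩, hint, V, hV, hVU, δ, hδ0, hb'⟩ :=
      hδ _ hy
    have hp' : 0 < dp y := by rwa [← hpos y, hdp]
    have hm' : dm y < 0 := by rwa [← hneg y, hdm]
    have ca : connectedComponentIn (e ⁻¹' U \ e ⁻¹' S) (e.symm a) =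
        e ⁻¹' connectedComponentIn (U \ S) a := e.preimage_connectedComponentIn ha
    have cb : connectedComponentIn (e ⁻¹' U \ e ⁻¹' S) (e.symm b) =
        e ⁻¹' connectedComponentIn (U \ S) b := e.preimage_connectedComponentIn hb
    have mono {s t : ℝ} : k.time y s ≤ k.time y t ↔ s ≤ t := (k.time_strictMono y).le_iff_le
    refine ⟨hp', hm', e ⁻¹' U, e.continuous.continuousAt.preimage_mem_nhds hU, hflat.preimage e,
      ⟨e.symm a, by simpa using ha, e.symm b, by simpa using hb, ?_, fun t ht => ?_,
        fun t ht => ?_⟩, ?_, ?_⟩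
    · rw [ca, cb]
      exact fun heq => hab (e.surjective.preimage_injective heq)
    · rw [ca, mem_preimage, hflow]
      exact hca _ ⟨by rw [← hdm]; exact mono.2 ht.1, (hneg y t).2 ht.2⟩
    · rw [cb, mem_preimage, hflow]
      exact hcb _ ⟨(hpos y t).2 ht.1, by rw [← hdp]; exact mono.2 ht.2⟩
    · refine Subset.antisymm ?_ ?_
      · rintro _ ⟨⟨t, ht, rfl⟩, htS⟩
        refine e.injective (?_ : e (Ψ t y) ∈ ({e y} : Set X))
        rw [← hint]
        refine ⟨⟨k.time y t, ⟨?_, ?_⟩, (hflow y t).symm⟩, htS⟩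
        · rw [← hdm]; exact mono.2 ht.1
        · rw [← hdp]; exact mono.2 ht.2
      · rintro _ rfl
        exact ⟨⟨0, ⟨hm'.le, hp'.le⟩, Ψ.map_zero_apply _⟩, hy⟩
    · obtain ⟨C, hC, hev⟩ := hk y hy
      -- The bound 1 keeps the time in the range controlled by `hk`; the bound δ / C makes its image
      -- under the time change at most δ in absolute value.
      refine ⟨e ⁻¹' V ∩ {z | z ∈ e ⁻¹' S → ∀ t ∈ Icc (0 : ℝ) 1,
        k.time z t ≤ t * C ∧ -(t * C) ≤ k.time z (-t)},
        inter_mem (e.continuous.continuousAt.preimage_mem_nhds hV) hev,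
        fun z hz => hVU hz.1, min 1 (δ / C), by positivity, fun z hz => ?_⟩
      obtain ⟨⟨hzV, hzC⟩, hzS⟩ := hz
      obtain ⟨h1, h2⟩ := hb' _ ⟨hzV, hzS⟩
      obtain ⟨h3, h4⟩ := hzC hzS (min 1 (δ / C)) ⟨by positivity, min_le_left _ _⟩
      have h5 : min 1 (δ / C) * C ≤ δ := by
        rw [← le_div_iff₀ hC]
        exact min_le_right _ _
      exact ⟨(k.time_strictMono z).lt_iff_lt.1 (by rw [hdp]; linarith),
        (k.time_strictMono z).lt_iff_lt.1 (by rw [hdm]; linarith)⟩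
  · exact (isCompact_Icc.image (by fun_prop)).inter_right hclosed
  · obtain ⟨t, ht, htS⟩ := (hS.hits (e y)).1
    obtain ⟨s, rfl⟩ := hsurj y t
    exact ⟨s, (hpos y s).1 ht, by rwa [mem_preimage, hflow]⟩
  · obtain ⟨t, ht, htS⟩ := (hS.hits (e y)).2
    obtain ⟨s, rfl⟩ := hsurj y t
    exact ⟨s, (hneg y s).1 ht, by rwa [mem_preimage, hflow]⟩

/-- At a section point w and for t in [0, 1], the time change is t T(w) forward and -t T(f⁻¹ w)
backward; both rates are continuous in w, hence locally bounded. -/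
theorem IsCrossSection.eventually_weakMorphism_time_le {X : Type*} [TopologicalSpace X]
    {Φ : Flow ℝ X} {S : Set X} (h : IsCrossSection Φ S) (y : MappingTorus h.poincareHomeomorph)
    (hy : y ∈ h.torusHomeomorph ⁻¹' S) :
    ∃ C > 0, ∀ᶠ z in 𝓝 y, z ∈ h.torusHomeomorph ⁻¹' S → ∀ t ∈ Icc (0 : ℝ) 1,
      h.weakMorphism.time z t ≤ t * C ∧ -(t * C) ≤ h.weakMorphism.time z (-t) := by
  let M (x : S) : ℝ :=
    max (returnTime Φ S x) (returnTime Φ S (h.poincareHomeomorph.symm x))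
  have hM : Continuous M := h.continuous_returnTime.max
    (h.continuous_returnTime.comp h.poincareHomeomorph.symm.continuous)
  let x : S := ⟨h.torusHomeomorph y, hy⟩
  have hx : 0 < M x := lt_max_of_lt_left (h.returnTime_pos x.2)
  have hev : ∀ᶠ w in 𝓝 x, M w < M x + 1 := hM.continuousAt.eventually_lt_const (by linarith)
  obtain ⟨W, hW, hWM⟩ := mem_nhds_subtype _ _ _ |>.1 hev
  refine ⟨M x + 1, by linarith, ?_⟩
  filter_upwards [h.torusHomeomorph.continuous.continuousAt.preimage_mem_nhds hW]
    with z hzW hzS t ht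
  have hlt : M ⟨h.torusHomeomorph z, hzS⟩ < M x + 1 := hWM hzW
  rw [h.torusHomeomorph_preimage] at hzS
  obtain ⟨w, rfl⟩ := hzS
  have hw : M w < M x + 1 := by
    convert hlt
    simp [torusHomeomorph_mk]
  obtain ⟨h1, h2⟩ := max_lt_iff.1 hw
  simp only [weakMorphism_time_mk_zero]
  rw [h.turnTime_coe w ⟨t, ht⟩, h.turnTime_neg_coe w ⟨t, ht⟩]
  exact ⟨mul_le_mul_of_nonneg_left h1.le ht.1,
    neg_le_neg (mul_le_mul_of_nonneg_left h2.le ht.1)⟩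

theorem mainTheorem4 {X : Type*} [TopologicalSpace X] (n : ℕ) (hX : IsTopologicalManifold n X)
    (Φ : Flow ℝ X) (S : Set X) (hS : IsGlobalPoincareSection n Φ S) :
    ∃ f : S ≃ₜ S, IsPoincareMap Φ S f ∧
      IsTopologicalManifold n (MappingTorus f) ∧
      IsGlobalPoincareSection n (suspensionFlow f) (MappingTorus.zeroSection f) ∧
      TopologicallyEquivalent Φ S (suspensionFlow f) (MappingTorus.zeroSection f) := by
  have h := hS.isCrossSection
  refine ⟨h.poincareHomeomorph, h.isPoincareMap, hX.of_homeomorph h.torusHomeomorph.symm, ?_, ?_⟩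
  · rw [← h.torusHomeomorph_preimage]
    exact hS.preimage h.weakMorphism h.torusHomeomorph (fun _ => rfl)
      h.eventually_weakMorphism_time_le
  · rw [← h.torusHomeomorph_preimage]
    exact h.weakMorphism.topologicallyEquivalent h.torusHomeomorph (fun _ => rfl) S
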